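/- Consider $n$ non-strategic and $m$ strategic agents, each having an opinion in $\mathbb{R}$ at every time $t\in\mathbb{N}_{\ge 0}$. The starting opinions $x_1(0),\dots,x_n(0)$ of the non-strategic agents are given, and each strategic agent may choose an arbitrary opinion at every time $t$. The opinion $x_i(t+1)$ of a non-strategic agent $i$ is the arithmetic mean of the opinions at time $t$ of all agents (strategic or not, including $i$ itself) whose opinion at time $t$ has distance at most $1$ from $x_i(t)$. The system has converged at time $t$ if for any two non-strategic agents $i,j$ either $x_i(t)=x_j(t)$ or $|x_i(t)-x_j(t)|>1$; its convergence time is the smallest $t$ at which it has converged ($\infty$ if there is none). The optimal convergence time, given the starting opinions of the non-strategic agents and $m$, is the minimum of the convergence time over all choices of the opinions of the strategic agents at all times. Let $f(n,m)$ be the supremum of the optimal convergence time over all starting opinions of the $n$ non-strategic agents. Then for each $\alpha\in[0,1]$ we have $$f(n,n^\alpha)\in\Omega\!\left(n^{\frac{2-2\alpha}{3}}\right),$$ where $n^\alpha$ may be rounded down or up to an integer. That is, for each $\alpha\in[0,1]$ there are a constant $c>0$ and an integer $n_0$ such that $f(n,m)\ge c\,n^{(2-2\alpha)/3}$ for all $n\ge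 n_0$ and $m\in\{\lfloor n^\alpha\rfloor,\lceil n^\alpha\rceil\}$. -/

import Mathlib

namespace HegselmannKrause

noncomputable section

/-- The neighborhood of the agent `a`, when the agents of the finite set `A` have the opinions
`p`: all agents (including `a`) whose opinion is at distance at most `1` from that of `a`. -/
def neighborhood {A : Type*} [Fintype A] (p : A → ℝ) (a : A) : Finset A :=
  Finset.univ.filter fun j => |p a - p j| ≤ 1

/-- One round of the dynamics: the `n` non-strategic agents have opinions `x`, the `m` strategic
agents have opinions `s`, and every non-strategic agent moves to the mean of the opinions in its
neighborhood, taken among all agents. -/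
def step {n m : ℕ} (x : Fin n → ℝ) (s : Fin m → ℝ) : Fin n → ℝ := fun i =>
  (∑ j ∈ neighborhood (Sum.elim x s) (Sum.inl i), Sum.elim x s j) /
    ((neighborhood (Sum.elim x s) (Sum.inl i)).card : ℝ)

/-- The opinions of the non-strategic agents at time `t`, for starting opinions `x₀`, when the
strategic agents choose the opinions `s t` at time `t`. -/
def opinions {n m : ℕ} (x₀ : Fin n → ℝ) (s : ℕ → Fin m → ℝ) : ℕ → Fin n → ℝ
  | 0 => x₀
  | t + 1 => step (opinions x₀ s t) (s t)

/-- The non-strategic agents with opinions `x` have converged (all of them are frozen): any two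
of them have the same opinion or are at distance more than `1`. -/
def Converged {n : ℕ} (x : Fin n → ℝ) : Prop :=
  ∀ i j, x i = x j ∨ 1 < |x i - x j|

/-- The smallest time at which the system has converged, `⊤` if there is none. -/
def convergenceTime {n m : ℕ} (x₀ : Fin n → ℝ) (s : ℕ → Fin m → ℝ) : ℕ∞ :=
  ⨅ (t : ℕ) (_ : Converged (opinions x₀ s t)), (t : ℕ∞)

/-- The least convergence time that `m` strategic agents can achieve from the starting opinions
`x₀`. -/
def optimalConvergenceTime {n : ℕ} (x₀ : Fin n → ℝ) (m : ℕ) : ℕ∞ :=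
  ⨅ s : ℕ → Fin m → ℝ, convergenceTime x₀ s

/-- `f n m`: the supremum of the optimal convergence time over all starting opinions of `n`
non-strategic agents, in the presence of `m` strategic agents. -/
def f (n m : ℕ) : ℕ∞ :=
  ⨆ x₀ : Fin n → ℝ, optimalConvergenceTime x₀ m

end

end HegselmannKrause

namespace HegselmannKrause

/-! Put k = ⌊(n - 1)/2⌋ agents at -3/4, k at 3/4, and the remaining one or two at 0. The outer
clusters do not see each other, so per round each is pulled by at most m + 2 agents and moves by at
most (m + 2)/k. The middle agents see both clusters, whose 2k agents outweigh the m strategic ones,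
so they stay near the midpoint of the clusters (`localMean_threeClusters`). For about k/(20(m + 2))
rounds the middle therefore remains within distance 1 of an outer cluster without merging with it
(`opinions_threeClusters`). This gives order n^(1 - α), more than the claimed exponent. -/

/-- The mean of those values of `v` that are at distance at most `1` from `y`. -/
noncomputable def localMean {A : Type*} [Fintype A] (v : A → ℝ) (y : ℝ) : ℝ :=
  (∑ j ∈ Finset.univ.filter fun j => |y - v j| ≤ 1, v j) /
    ((Finset.univ.filter fun j => |y - v j| ≤ 1).card : ℝ)

theorem step_eq_localMean {n m : ℕ} (x : Fin n → ℝ) (s : Fin m → ℝ) (i : Fin n) :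
    step x s i = localMean (Sum.elim x s) (x i) := rfl

/-- A mean over `S` is close to `c` if the deviations from `c` nearly cancel over a subset `T`
of `S`, and `S \ T` is small. -/
theorem abs_mean_sub_le {A : Type*} [DecidableEq A] {S T : Finset A} (hTS : T ⊆ S) (v : A → ℝ)
    {c D L M K : ℝ} (hD : |∑ j ∈ T, (v j - c)| ≤ D) (hL : ∀ j ∈ S \ T, |v j - c| ≤ L)
    (hL0 : 0 ≤ L) (hM : ((S \ T).card : ℝ) ≤ M) (hK : 0 < K) (hKS : K ≤ S.card) :
    |(∑ j ∈ S, v j) / (S.card : ℝ) - c| ≤ (D + M * L) / K := by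
  have hS : (0 : ℝ) < S.card := hK.trans_le hKS
  have hmean : (∑ j ∈ S, v j) / (S.card : ℝ) - c = (∑ j ∈ S, (v j - c)) / S.card := by
    rw [Finset.sum_sub_distrib, Finset.sum_const, nsmul_eq_mul]
    field_simp
  have hrest : |∑ j ∈ S \ T, (v j - c)| ≤ M * L :=
    calc |∑ j ∈ S \ T, (v j - c)| ≤ ∑ j ∈ S \ T, |v j - c| := Finset.abs_sum_le_sum_abs _ _
      _ ≤ (S \ T).card • L := Finset.sum_le_card_nsmul _ _ _ hL
      _ = (S \ T).card * L := nsmul_eq_mul _ _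
      _ ≤ M * L := mul_le_mul_of_nonneg_right hM hL0
  have hsum : |∑ j ∈ S, (v j - c)| ≤ D + M * L := by
    rw [← Finset.sum_sdiff hTS, add_comm]
    exact (abs_add_le _ _).trans (add_le_add hD hrest)
  rw [hmean, abs_div, abs_of_pos hS]
  exact div_le_div₀ ((abs_nonneg _).trans hsum) hsum hK hKS

/-- A cluster of `k` agents at `y` moves by at most `M / k` if at most `M` other agents can be
within distance `1`. -/
theorem abs_localMean_sub_le {A : Type*} [Fintype A] [DecidableEq A] {v : A → ℝ} {y : ℝ}
    {T R : Finset A} (hT : ∀ j ∈ T, v j = y) (hR : ∀ j, |y - v j| ≤ 1 → j ∈ T ∨ j ∈ R)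
    {M : ℝ} (hM : (R.card : ℝ) ≤ M) (hpos : 0 < T.card) :
    |localMean v y - y| ≤ M / T.card := by
  have hTS : T ⊆ Finset.univ.filter fun j => |y - v j| ≤ 1 := fun j hj => by
    simp [hT j hj]
  have h := abs_mean_sub_le (c := y) (D := 0) (L := 1) (M := M) (K := T.card) hTS v
    (by rw [Finset.sum_eq_zero fun j hj => by rw [hT j hj, sub_self], abs_zero])
    (fun j hj => by
      rw [abs_sub_comm]
      exact (Finset.mem_filter.1 (Finset.mem_sdiff.1 hj).1).2)
    zero_le_one
    ((Nat.cast_le.2 (Finset.card_le_card fun j hj => by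
      obtain ⟨hjS, hjT⟩ := Finset.mem_sdiff.1 hj
      exact (hR j (Finset.mem_filter.1 hjS).2).resolve_left hjT)).trans hM)
    (by exact_mod_cast hpos) (by exact_mod_cast Finset.card_le_card hTS)
  simpa [localMean] using h

/-- The opinions where the agents of `P` are at `p`, those of `Q` at `q`, and all others at `z`. -/
def threeClusters {n : ℕ} (P Q : Finset (Fin n)) (p q z : ℝ) (i : Fin n) : ℝ :=
  if i ∈ P then p else if i ∈ Q then q else z

/-- Agents with equal opinions have equal neighborhoods, so clusters never split, whatever the
strategic agents do. -/
theorem step_threeClusters {n m : ℕ} (P Q : Finset (Fin n)) (p q z : ℝ) (s : Fin m → ℝ) :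
    step (threeClusters P Q p q z) s = threeClusters P Q
      (localMean (Sum.elim (threeClusters P Q p q z) s) p)
      (localMean (Sum.elim (threeClusters P Q p q z) s) q)
      (localMean (Sum.elim (threeClusters P Q p q z) s) z) := by
  funext i
  rw [step_eq_localMean]
  generalize Sum.elim (threeClusters P Q p q z) s = v
  unfold threeClusters
  split_ifs <;> rfl

/-- While the outer clusters are near `±3/4` and the middle one is near `0`, the strategic agents
and the middle cluster move the outer clusters only a little, and the middle cluster stays near
the midpoint of the outer ones. -/
theorem localMean_threeClusters {n m k : ℕ} {P Q : Finset (Fin n)} (hPQ : Disjoint P Q)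
    (hP : P.card = k) (hQ : Q.card = k) (hk : 0 < k) (hn : n ≤ 2 * k + 2) {p q z : ℝ}
    (hp : |p + 3 / 4| ≤ 1 / 20) (hq : |q - 3 / 4| ≤ 1 / 20) (hz : |z| ≤ 1 / 10)
    (s : Fin m → ℝ) :
    |localMean (Sum.elim (threeClusters P Q p q z) s) p - p| ≤ ((m : ℝ) + 2) / k ∧
    |localMean (Sum.elim (threeClusters P Q p q z) s) q - q| ≤ ((m : ℝ) + 2) / k ∧
    |localMean (Sum.elim (threeClusters P Q p q z) s) z| ≤
      |p + q| / 2 + ((m : ℝ) + 2) / k * (11 / 20) := by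
  obtain ⟨hp1, hp2⟩ := abs_le.1 hp
  obtain ⟨hq1, hq2⟩ := abs_le.1 hq
  obtain ⟨hz1, hz2⟩ := abs_le.1 hz
  set v := Sum.elim (threeClusters P Q p q z) s with hv
  let P' : Finset (Fin n ⊕ Fin m) := P.map Function.Embedding.inl
  let Q' : Finset (Fin n ⊕ Fin m) := Q.map Function.Embedding.inl
  have hP' : P'.card = k := by simp [P', hP]
  have hQ' : Q'.card = k := by simp [Q', hQ]
  have hd : Disjoint P' Q' := (Finset.disjoint_map _).2 hPQ
  have hvP : ∀ j ∈ P', v j = p := by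
    intro j hj
    obtain ⟨i, hi, rfl⟩ := Finset.mem_map.1 hj
    simp [hv, threeClusters, hi]
  have hvQ : ∀ j ∈ Q', v j = q := by
    intro j hj
    obtain ⟨i, hi, rfl⟩ := Finset.mem_map.1 hj
    simp [hv, threeClusters, hi, Finset.disjoint_right.1 hPQ hi]
  have hunion : (P' ∪ Q').card = 2 * k := by
    rw [Finset.card_union_of_disjoint hd, hP', hQ', two_mul]
  have hR : (((P' ∪ Q')ᶜ).card : ℝ) ≤ (m : ℝ) + 2 := by
    have : ((P' ∪ Q')ᶜ).card ≤ m + 2 := by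
      rw [Finset.card_compl, hunion, Fintype.card_sum, Fintype.card_fin, Fintype.card_fin]
      omega
    exact_mod_cast this
  have hk' : (0 : ℝ) < k := by exact_mod_cast hk
  refine ⟨?_, ?_, ?_⟩
  -- The other outer cluster is out of sight: q - p ≥ 3/2 - 1/10 > 1.
  · have h := abs_localMean_sub_le (R := (P' ∪ Q')ᶜ) hvP (fun j hj => by
      by_contra! hc
      have hjQ : j ∈ Q' := by simpa [hc.1] using hc.2
      rw [hvQ j hjQ] at hj
      linarith [(abs_le.1 hj).1]) hR (by omega)
    rwa [hP'] at h
  · have h := abs_localMean_sub_le (R := (P' ∪ Q')ᶜ) hvQ (fun j hj => by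
      by_contra! hc
      have hjP : j ∈ P' := by simpa [hc.1] using hc.2
      rw [hvP j hjP] at hj
      linarith [(abs_le.1 hj).2]) hR (by omega)
    rwa [hQ'] at h
  · have hTS : P' ∪ Q' ⊆ Finset.univ.filter fun j => |z - v j| ≤ 1 := fun j hj => by
      refine Finset.mem_filter.2 ⟨Finset.mem_univ _, ?_⟩
      rcases Finset.mem_union.1 hj with h | h
      · rw [hvP j h, abs_le]; constructor <;> linarith
      · rw [hvQ j h, abs_le]; constructor <;> linarith
    have hD : |∑ j ∈ P' ∪ Q', (v j - 0)| ≤ k * |p + q| := by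
      rw [Finset.sum_union hd, Finset.sum_congr rfl fun j hj => by rw [hvP j hj],
        Finset.sum_congr (s₁ := Q') rfl fun j hj => by rw [hvQ j hj]]
      simp only [sub_zero, Finset.sum_const, hP', hQ', nsmul_eq_mul]
      rw [← mul_add, abs_mul, abs_of_pos hk']
    -- Neighbors of z are within 1 + 1/10 of 0; dividing 11/10 by the 2k visible outer agents gives
    -- the factor 11/20.
    have h := abs_mean_sub_le (c := 0) (L := 11 / 10) (K := 2 * k) hTS v hD
      (fun j hj => by
        have := abs_le.1 (Finset.mem_filter.1 (Finset.mem_sdiff.1 hj).1).2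
        rw [abs_le]
        constructor <;> linarith)
      (by norm_num)
      ((Nat.cast_le.2 (Finset.card_le_card fun j hj =>
        Finset.mem_compl.2 (Finset.mem_sdiff.1 hj).2)).trans hR)
      (by positivity)
      (by
        have := Finset.card_le_card hTS
        rw [hunion] at this
        exact_mod_cast this)
    rw [sub_zero] at h
    refine h.trans_eq ?_
    field_simp
    ring

/-- The three clusters stay near `-3/4`, `3/4` and `0` as long as the accumulated influence of
the strategic agents and of the middle cluster is small. -/
theorem opinions_threeClusters {n m k : ℕ} {P Q : Finset (Fin n)} (hPQ : Disjoint P Q)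
    (hP : P.card = k) (hQ : Q.card = k) (hk : 0 < k) (hn : n ≤ 2 * k + 2)
    (s : ℕ → Fin m → ℝ) (t : ℕ) (ht : (t : ℝ) * (((m : ℝ) + 2) / k) ≤ 1 / 20) :
    ∃ p q z : ℝ, opinions (threeClusters P Q (-(3 / 4)) (3 / 4) 0) s t = threeClusters P Q p q z ∧
      |p + 3 / 4| ≤ t * (((m : ℝ) + 2) / k) ∧ |q - 3 / 4| ≤ t * (((m : ℝ) + 2) / k) ∧
      |z| ≤ 1 / 10 := by
  induction t with
  | zero => exact ⟨-(3 / 4), 3 / 4, 0, rfl, by norm_num, by norm_num, by norm_num⟩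
  | succ t ih =>
    have hδ : 0 ≤ ((m : ℝ) + 2) / k := by positivity
    push_cast at ht ⊢
    set δ := ((m : ℝ) + 2) / k with hδ'
    have htδ : 0 ≤ (t : ℝ) * δ := by positivity
    obtain ⟨p, q, z, hx, hp, hq, hz⟩ := ih (by linarith)
    obtain ⟨h1, h2, h3⟩ := localMean_threeClusters hPQ hP hQ hk hn (p := p) (q := q) (z := z)
      (by linarith) (by linarith) hz (s t)
    refine ⟨_, _, _, (congrArg (fun x => step x (s t)) hx).trans
      (step_threeClusters P Q p q z (s t)), ?_, ?_, ?_⟩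
    · rw [abs_le] at *
      constructor <;> linarith
    · rw [abs_le] at *
      constructor <;> linarith
    -- The error of z does not accumulate: it depends only on the current p + q, so the new |z| is
    -- at most tδ + 11δ/20 ≤ (t + 1)δ ≤ 1/20.
    · have hpq : |p + q| ≤ 2 * (t * δ) := by
        rw [abs_le] at *
        constructor <;> linarith
      linarith

theorem not_converged_threeClusters {n : ℕ} {P Q : Finset (Fin n)} {p q z : ℝ} {i j : Fin n}
    (hi : i ∈ P) (hjP : j ∉ P) (hjQ : j ∉ Q) (hne : p ≠ z) (hpz : |p - z| ≤ 1) :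
    ¬ Converged (threeClusters P Q p q z) := by
  intro h
  have hij := h i j
  simp only [threeClusters, hi, hjP, hjQ, if_true, if_false] at hij
  exact hij.elim hne hpz.not_gt

/-- With `2 * k + 1` or `2 * k + 2` non-strategic agents, `m` strategic agents need time at least
`k / (20 * (m + 2))` in the worst case. -/
theorem le_f {n m k : ℕ} (hk : 0 < k) (hkn : 2 * k < n) (hn : n ≤ 2 * k + 2) :
    ENNReal.ofReal ((k : ℝ) / (20 * (m + 2))) ≤ ((f n m : ℕ∞) : ENNReal) := by
  obtain ⟨P, -, hP⟩ := Finset.exists_subset_card_eq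
    (s := (Finset.univ : Finset (Fin n))) (n := k) (by simp; omega)
  obtain ⟨Q, hQP, hQ⟩ := Finset.exists_subset_card_eq (s := Pᶜ) (n := k)
    (by rw [Finset.card_compl, hP, Fintype.card_fin]; omega)
  have hPQ : Disjoint P Q :=
    Finset.disjoint_right.2 fun i hi => Finset.mem_compl.1 (hQP hi)
  obtain ⟨i, hi⟩ : P.Nonempty := Finset.card_pos.1 (by omega)
  obtain ⟨j, hj⟩ : ∃ j, j ∉ P ∪ Q := by
    by_contra! h
    have := Finset.card_le_card (fun j _ => h j : (Finset.univ : Finset (Fin n)) ⊆ P ∪ Q)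
    rw [Finset.card_union_of_disjoint hPQ, Finset.card_univ, Fintype.card_fin] at this
    omega
  rw [Finset.mem_union, not_or] at hj
  have hk' : (0 : ℝ) < k := by exact_mod_cast hk
  have hbound : ((⌈(k : ℝ) / (20 * (m + 2))⌉₊ : ℕ) : ℕ∞) ≤ f n m := by
    refine le_iSup_of_le (threeClusters P Q (-(3 / 4)) (3 / 4) 0)
      (le_iInf fun s => le_iInf₂ fun t ht => ?_)
    rw [Nat.cast_le, Nat.ceil_le]
    by_contra! hlt
    have htm : (t : ℝ) * (((m : ℝ) + 2) / k) ≤ 1 / 20 := by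
      rw [lt_div_iff₀ (by positivity)] at hlt
      rw [← mul_div_assoc, div_le_iff₀ hk']
      linarith
    -- With p within 1/20 of -3/4 and |z| ≤ 1/10, the gap z - p lies in [0.6, 0.9].
    obtain ⟨p, q, z, hx, hp, -, hz⟩ := opinions_threeClusters hPQ hP hQ hk hn s t htm
    have hp' := abs_le.1 (hp.trans htm)
    have hz' := abs_le.1 hz
    rw [hx] at ht
    refine not_converged_threeClusters hi hj.1 hj.2 ?_ ?_ ht
    · intro h
      linarith [hp'.2, hz'.1]
    · rw [abs_le]
      constructor <;> linarith [hp'.1, hp'.2, hz'.1, hz'.2]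
  calc ENNReal.ofReal ((k : ℝ) / (20 * (m + 2)))
      ≤ ENNReal.ofReal (⌈(k : ℝ) / (20 * (m + 2))⌉₊ : ℕ) :=
        ENNReal.ofReal_le_ofReal (Nat.le_ceil _)
    _ = (((⌈(k : ℝ) / (20 * (m + 2))⌉₊ : ℕ) : ℕ∞) : ENNReal) := by
        rw [ENNReal.ofReal_natCast, ENat.toENNReal_coe]
    _ ≤ ((f n m : ℕ∞) : ENNReal) := ENat.toENNReal_le.2 hbound

end HegselmannKrause

theorem mainTheorem4 (α : ℝ) (hα : α ∈ Set.Icc (0 : ℝ) 1) :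
    ∃ c : ℝ, 0 < c ∧ ∃ n₀ : ℕ, ∀ n : ℕ, n₀ ≤ n → ∀ m : ℕ,
      (m = ⌊(n : ℝ) ^ α⌋₊ ∨ m = ⌈(n : ℝ) ^ α⌉₊) →
        ENNReal.ofReal (c * (n : ℝ) ^ ((2 - 2 * α) / 3)) ≤
          ((HegselmannKrause.f n m : ℕ∞) : ENNReal) := by
  -- 480 = 6 · 20 · 4, from n ≤ 6k and m + 2 ≤ n^α + 3 ≤ 4n^α; n ≥ 3 ensures k ≥ 1.
  refine ⟨1 / 480, by norm_num, 3, fun n hn m hm => ?_⟩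
  have hn1 : (1 : ℝ) ≤ n := by exact_mod_cast (by omega : 1 ≤ n)
  have hn0 : (0 : ℝ) < n := by linarith
  have hpow : (1 : ℝ) ≤ (n : ℝ) ^ α := Real.one_le_rpow hn1 hα.1
  have hmle : (m : ℝ) ≤ (n : ℝ) ^ α + 1 := by
    rcases hm with rfl | rfl
    · linarith [Nat.floor_le (zero_le_one.trans hpow)]
    · exact (Nat.ceil_lt_add_one (zero_le_one.trans hpow)).le
  obtain ⟨k, hk⟩ : ∃ k, k = (n - 1) / 2 := ⟨_, rfl⟩
  refine le_trans (ENNReal.ofReal_le_ofReal ?_)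
    (HegselmannKrause.le_f (k := k) (by omega) (by omega) (by omega))
  have hkn : (n : ℝ) ≤ 6 * k := by exact_mod_cast (by omega : n ≤ 6 * k)
  -- Since α ≤ 1, (2 - 2α)/3 ≤ 1 - α.
  calc 1 / 480 * (n : ℝ) ^ ((2 - 2 * α) / 3) ≤ 1 / 480 * (n : ℝ) ^ (1 - α) := by
        gcongr
        linarith [hα.2]
    _ = (n : ℝ) / 6 / (20 * (4 * (n : ℝ) ^ α)) := by
        rw [Real.rpow_sub hn0, Real.rpow_one]
        field_simp
        norm_num
    _ ≤ (k : ℝ) / (20 * (m + 2)) := by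
        apply div_le_div₀ (by positivity) (by linarith) (by positivity)
        linarith
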